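/- Setting. Let $(\Gamma,d)$ be a countable metric space. To each $x\in\Gamma$ a finite-dimensional complex Hilbert space $\mathcal H_x$ is attached; for finite $\Lambda\subset\Gamma$ put $\mathcal H_\Lambda=\bigotimes_{x\in\Lambda}\mathcal H_x$ and $\mathcal A_\Lambda=\mathcal B(\mathcal H_\Lambda)$ with the operator norm, and for $\Lambda_0\subset\Lambda$ identify $A\in\mathcal A_{\Lambda_0}$ with $A\otimes 1_{\Lambda\setminus\Lambda_0}\in\mathcal A_\Lambda$. For $Z \subset \Lambda$, a linear map $\Phi$ on $\mathcal A_Z$ acts on $\mathcal A_\Lambda$ as $\Phi\otimes\mathrm{id}_{\Lambda\setminus Z}$, and $\|\Phi\|_{cb}=\sup_{k\in\mathbb N}\|\Phi\otimes\mathrm{id}_{\mathbb M_k}\|$. A dissipative interaction is a family $\mathscr L=\{L_Z\}$, indexed by the finite sets $Z\subset\Gamma$, of linear maps $L_Z:\mathcal A_Z\to\mathcal A_Z$ of Lindblad form: there are $H_Z=H_Z^*\in\mathcal A_Z$, $\ell_Z \in \mathbb N$ and $K_1,\dots,K_{\ell_Z}\in\mathcal A_Z$ with $L_Z(A)=i[H_Z,A]+\sum_{j=1}^{\ell_Z}\big(K_j^*AK_j-\tfrac12\{K_j^*K_j,A\}\big)$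 for all $A\in\mathcal A_Z$. For finite $\Lambda \subset \Gamma$ and $t\ge 0$ set $\mathscr L^\Lambda=\sum_{Z\subset\Lambda}L_Z$ and $T_t^\Lambda=e^{t\mathscr L^\Lambda}$. An $F$-function on $(\Gamma,d)$ is a non-increasing $F:[0,\infty)\to(0,\infty)$ with $\|F\|=\sup_{x}\sum_{y}F(d(x,y))<\infty$ such that for some $C>0$ one has $\sum_{z}F(d(x,z))F(d(z,y))\le C\,F(d(x,y))$ for all $x,y\in\Gamma$; $C_F$ is the infimum of all such $C$. Let $\|\mathscr L\|_F$ be the infimum of all $M$ with $\sum_{Z\ni x,y}\|L_Z\|_{cb}\le M\,F(d(x,y))$ for all $x,y\in\Gamma$ (the sum is over finite $Z \subset \Gamma$). Theorem. Let $F$ be an $F$-function on $(\Gamma,d)$ and $\mathscr L$ a dissipative interaction with $\|\mathscr L\|_F<\infty$. Let $X\subset\Lambda\subset\Gamma$ be finite sets and $A\in\mathcal A_X$. For $r\ge 1$ let $X(r)=\{y\in\Lambda: d(y,x)\le r\text{ for some }x\in X\}$ be the $r$-inflation of $X$ inside $\Lambda$. Then, for all $t\ge0$ and $r\ge1$, $$\|T_t^\Lambda(A)-T_t^{X(r)}(A)\|\le\|A\|\,\|\mathscr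 L\|_F\Big(t+\frac{C_F+\|F\|}{C_F}\int_0^t(e^{vs}-1)\,ds\Big)\sum_{x\in X}\ \sum_{y\in\Lambda\setminus X(r)}F(d(x,y)),$$ where $v=\|\mathscr L\|_F\,C_F$. -/

import Mathlib

open scoped ENNReal Matrix.Norms.L2Operator Kronecker

noncomputable section

namespace QSpin

/-! ### Completely bounded norm and Lindblad form on a full matrix algebra

`Matrix m m ℂ` carries the operator norm of `B(ℂ^m)`, that is, its C⋆-norm. -/

/-- The map `Φ ⊗ id` on `B(ℂ^m) ⊗ B(ℂ^κ) = B(ℂ^(m × κ))`: a matrix over `m × κ` is read as a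
`κ × κ` matrix with entries in `B(ℂ^m)`, and `Φ` acts on every entry. -/
def ampliation {m : Type*} (κ : Type*) (Φ : Matrix m m ℂ →ₗ[ℂ] Matrix m m ℂ) :
    Matrix (m × κ) (m × κ) ℂ →ₗ[ℂ] Matrix (m × κ) (m × κ) ℂ where
  toFun M := Matrix.of fun p q => Φ (Matrix.of fun a b => M (a, p.2) (b, q.2)) p.1 q.1
  map_add' M N := by
    ext p q
    exact congrFun (congrFun (Φ.map_add (Matrix.of fun a b => M (a, p.2) (b, q.2))
      (Matrix.of fun a b => N (a, p.2) (b, q.2))) p.1) q.1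
  map_smul' c M := by
    ext p q
    exact congrFun (congrFun (Φ.map_smul c (Matrix.of fun a b => M (a, p.2) (b, q.2))) p.1) q.1

/-- The completely bounded norm `‖Φ‖_cb = sup_k ‖Φ ⊗ 1_{k × k}‖`. -/
def cbNorm {m : Type*} [Fintype m] [DecidableEq m] (Φ : Matrix m m ℂ →ₗ[ℂ] Matrix m m ℂ) :
    ℝ≥0∞ :=
  ⨆ k : ℕ, ‖LinearMap.toContinuousLinearMap (ampliation (Fin k) Φ)‖ₑ

/-- `Φ` is of Lindblad form:
`Φ(A) = i[H, A] + ∑ⱼ (Kⱼ* A Kⱼ - ½ {Kⱼ* Kⱼ, A})` with `H = H*` and finitely many `Kⱼ`. -/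
def IsLindblad {m : Type*} [Fintype m] (Φ : Matrix m m ℂ →ₗ[ℂ] Matrix m m ℂ) : Prop :=
  ∃ (H : Matrix m m ℂ) (ℓ : ℕ) (K : Fin ℓ → Matrix m m ℂ), IsSelfAdjoint H ∧
    ∀ A : Matrix m m ℂ,
      Φ A = Complex.I • (H * A - A * H) +
        ∑ j, (star (K j) * A * K j
          - (1 / 2 : ℂ) • (star (K j) * K j * A + A * (star (K j) * K j)))

/-! ### Quantum spin systems

The Hilbert space at the site `x` is `ℂ^(q x)`. -/

/-- Labels of the product orthonormal basis of `H_Λ = ⨂_{x ∈ Λ} ℂ^(q x)`. -/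
abbrev Conf {Γ : Type*} (q : Γ → ℕ) (Λ : Finset Γ) : Type _ := (x : Λ) → Fin (q x)

/-- The algebra of observables `A_Λ = B(H_Λ)`, `H_Λ = ⨂_{x ∈ Λ} ℂ^(q x)`, with its operator norm. -/
abbrev Obs {Γ : Type*} (q : Γ → ℕ) (Λ : Finset Γ) : Type _ := Matrix (Conf q Λ) (Conf q Λ) ℂ

/-- The decomposition `H_Λ = H_Z ⊗ H_{Λ ∖ Z}` for `Z ⊆ Λ`, on the level of basis labels. -/
def splitConf {Γ : Type*} [DecidableEq Γ] (q : Γ → ℕ) {Z Λ : Finset Γ} (h : Z ⊆ Λ) :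
    Conf q Λ ≃ Conf q Z × Conf q (Λ \ Z) where
  toFun σ := (fun x => σ ⟨x.1, h x.2⟩, fun x => σ ⟨x.1, (Finset.mem_sdiff.1 x.2).1⟩)
  invFun p := fun x =>
    if hx : x.1 ∈ Z then p.1 ⟨x.1, hx⟩ else p.2 ⟨x.1, Finset.mem_sdiff.2 ⟨x.2, hx⟩⟩
  left_inv σ := by
    funext x
    by_cases hx : x.1 ∈ Z <;> simp [hx]
  right_inv p := by
    refine Prod.ext ?_ ?_
    · funext x
      simp [x.2]
    · funext x
      have hx : x.1 ∉ Z := (Finset.mem_sdiff.1 x.2).2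
      simp [hx]

/-- The inclusion `A_Z ⊆ A_Λ`, `A ↦ A ⊗ 1_{Λ ∖ Z}`, for `Z ⊆ Λ`. -/
def embed {Γ : Type*} [DecidableEq Γ] (q : Γ → ℕ) {Z Λ : Finset Γ} (h : Z ⊆ Λ) (A : Obs q Z) :
    Obs q Λ :=
  Matrix.reindex (splitConf q h).symm (splitConf q h).symm
    (A ⊗ₖ (1 : Matrix (Conf q (Λ \ Z)) (Conf q (Λ \ Z)) ℂ))

/-- The map `Φ ⊗ id_{Λ ∖ Z}` on `A_Λ` for a linear map `Φ` on `A_Z` and `Z ⊆ Λ`. -/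
def extend {Γ : Type*} [DecidableEq Γ] (q : Γ → ℕ) {Z Λ : Finset Γ} (h : Z ⊆ Λ)
    (Φ : Obs q Z →ₗ[ℂ] Obs q Z) : Obs q Λ →ₗ[ℂ] Obs q Λ :=
  (Matrix.reindexLinearEquiv ℂ ℂ (splitConf q h).symm (splitConf q h).symm).toLinearMap ∘ₗ
    ampliation (Conf q (Λ \ Z)) Φ ∘ₗ
      (Matrix.reindexLinearEquiv ℂ ℂ (splitConf q h) (splitConf q h)).toLinearMap

/-- A dissipative interaction: a map `L_Z` of Lindblad form on `A_Z` for every finite `Z ⊆ Γ`. -/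
structure Interaction {Γ : Type*} [DecidableEq Γ] (q : Γ → ℕ) where
  /-- The local term `L_Z`. -/
  term : ∀ Z : Finset Γ, Obs q Z →ₗ[ℂ] Obs q Z
  lindblad : ∀ Z, IsLindblad (term Z)

/-- The finite-volume generator `∑_{Z ⊆ Λ} L_Z` on `A_Λ`. -/
def generator {Γ : Type*} [DecidableEq Γ] {q : Γ → ℕ} (L : Interaction q) (Λ : Finset Γ) :
    Obs q Λ →L[ℂ] Obs q Λ :=
  LinearMap.toContinuousLinearMap
    (∑ Z ∈ Λ.powerset.attach, extend q (Finset.mem_powerset.1 Z.2) (L.term Z.1))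

/-- The finite-volume dynamics `T_t^Λ`, the exponential of `t` times the generator. -/
def dynamics {Γ : Type*} [DecidableEq Γ] {q : Γ → ℕ} (L : Interaction q) (Λ : Finset Γ) (t : ℝ) :
    Obs q Λ →L[ℂ] Obs q Λ :=
  NormedSpace.exp ((t : ℂ) • generator L Λ)

/-! ### Decay functions -/

/-- `‖F‖ = sup_x ∑_y F(d(x, y))`. -/
def decayNorm (Γ : Type*) [MetricSpace Γ] (F : ℝ → ℝ) : ℝ≥0∞ :=
  ⨆ x : Γ, ∑' y : Γ, ENNReal.ofReal (F (dist x y))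

/-- `C` is an admissible constant in the convolution condition
`∑_z F(d(x, z)) F(d(z, y)) ≤ C F(d(x, y))`. -/
def IsConvBound (Γ : Type*) [MetricSpace Γ] (F : ℝ → ℝ) (C : ℝ) : Prop :=
  0 < C ∧ ∀ x y : Γ,
    ∑' z : Γ, ENNReal.ofReal (F (dist x z) * F (dist z y)) ≤ ENNReal.ofReal (C * F (dist x y))

/-- The convolution constant `C_F`. -/
def convConst (Γ : Type*) [MetricSpace Γ] (F : ℝ → ℝ) : ℝ :=
  sInf {C : ℝ | IsConvBound Γ F C}

/-- `F : [0, ∞) → (0, ∞)` is an `F`-function on `Γ`; only its values on `[0, ∞)` matter. -/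
structure IsDecayFunction (Γ : Type*) [MetricSpace Γ] (F : ℝ → ℝ) : Prop where
  pos : ∀ r, 0 ≤ r → 0 < F r
  antitone : AntitoneOn F (Set.Ici 0)
  summable : decayNorm Γ F < ∞
  conv : ∃ C : ℝ, IsConvBound Γ F C

/-- The `F`-norm of an interaction, the infimum of all `M` with
`∑_{Z ∋ x, y} ‖L_Z‖_cb ≤ M F(d(x, y))` for all `x, y`; it is `∞` if there is no such finite `M`. -/
def interactionNorm {Γ : Type*} [MetricSpace Γ] [DecidableEq Γ] {q : Γ → ℕ} (F : ℝ → ℝ)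
    (L : Interaction q) : ℝ≥0∞ :=
  sInf {M : ℝ≥0∞ | ∀ x y : Γ,
    ∑' Z : {Z : Finset Γ // x ∈ Z ∧ y ∈ Z}, cbNorm (L.term Z.1) ≤
      M * ENNReal.ofReal (F (dist x y))}

open Classical in
/-- The part `X(r) ∩ Λ` of the inflation `X(r) = {y | d(y, x) ≤ r for some x ∈ X}` inside `Λ`. -/
def inflate {Γ : Type*} [MetricSpace Γ] (Λ X : Finset Γ) (r : ℝ) : Finset Γ :=
  Λ.filter fun y => ∃ x ∈ X, dist y x ≤ r

theorem inflate_subset {Γ : Type*} [MetricSpace Γ] (Λ X : Finset Γ) (r : ℝ) :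
    inflate Λ X r ⊆ Λ :=
  Finset.filter_subset _ _

theorem subset_inflate {Γ : Type*} [MetricSpace Γ] {Λ X : Finset Γ} (h : X ⊆ Λ) {r : ℝ}
    (hr : 1 ≤ r) : X ⊆ inflate Λ X r := fun x hx =>
  Finset.mem_filter.2 ⟨h hx, x, hx, by rw [dist_self]; linarith⟩

end QSpin

end

/-!
Every sum of local terms is of Lindblad form, hence dissipative: `‖B‖ ≤ ‖B - h G B‖` for `h ≥ 0`.
Therefore a solution of `u' = G u + f` satisfies `‖u t‖ ≤ ‖u 0‖ + ∫₀ᵗ ‖f‖`, with no exponential in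
the norm of `G`. Apply this to `u = L_Z T_t A`: the terms supported away from `Z` commute with `L_Z`
and are absorbed into `G`, so that only the terms meeting `Z` are left in `f`. A bound on
`‖L_Z T_t A‖` inserted into this estimate returns the Lieb–Robinson bound plus half of the previous
error, and iterating removes the error. The dynamics of two volumes `Y ⊆ Λ` differ by a solution
whose forcing `f` is the sum of the terms meeting `Λ ∖ Y`, to which the Lieb–Robinson bound applies.
-/

noncomputable section

namespace QSpin

/-! ### Lindbladians -/

theorem commute_mulLeftRight {𝔄 : Type*} [Ring 𝔄] [Algebra ℂ 𝔄] {a b a' b' : 𝔄}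
    (ha : Commute a a') (hb : Commute b b') :
    Commute (LinearMap.mulLeftRight ℂ (a, b) : Module.End ℂ 𝔄)
      (LinearMap.mulLeftRight ℂ (a', b')) := by
  ext A
  simp only [Module.End.mul_apply, LinearMap.mulLeftRight_apply]
  rw [← mul_assoc, ← mul_assoc, ha.eq, mul_assoc _ b', ← hb.eq]
  simp only [mul_assoc]

section Lindbladian

variable {𝔄 𝔅 ι κ : Type*} [Ring 𝔄] [StarRing 𝔄] [Algebra ℂ 𝔄] [Ring 𝔅] [StarRing 𝔅]
  [Algebra ℂ 𝔅] [Fintype ι] [Fintype κ]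

/-- The Lindblad generator in Heisenberg form, with Hamiltonian `H` and jump operators `K j`, on an
arbitrary ⋆-algebra. It is built from two-sided multiplications `A ↦ a * A * b` only, since these
are what `ampliation` and commutation arguments act on. -/
def lindbladian (H : 𝔄) (K : ι → 𝔄) : Module.End ℂ 𝔄 :=
  Complex.I • (LinearMap.mulLeftRight ℂ (H, 1) - LinearMap.mulLeftRight ℂ (1, H)) +
    ∑ j, (LinearMap.mulLeftRight ℂ (star (K j), K j) -
      (1 / 2 : ℂ) • (LinearMap.mulLeftRight ℂ (star (K j) * K j, 1) +
        LinearMap.mulLeftRight ℂ (1, star (K j) * K j)))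

theorem lindbladian_apply (H : 𝔄) (K : ι → 𝔄) (A : 𝔄) :
    lindbladian H K A = Complex.I • (H * A - A * H) +
      ∑ j, (star (K j) * A * K j
        - (1 / 2 : ℂ) • (star (K j) * K j * A + A * (star (K j) * K j))) := by
  simp [lindbladian]

theorem map_lindbladian (φ : 𝔄 →⋆ₐ[ℂ] 𝔅) (H : 𝔄) (K : ι → 𝔄) (A : 𝔄) :
    φ (lindbladian H K A) = lindbladian (φ H) (φ ∘ K) (φ A) := by
  simp only [lindbladian_apply, map_mul, map_add, map_sub, map_smul, map_sum, map_star,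
    Function.comp_apply]

theorem lindbladian_add (H H' : 𝔄) (K : ι → 𝔄) (K' : κ → 𝔄) :
    lindbladian H K + lindbladian H' K' = lindbladian (H + H') (Sum.elim K K') := by
  ext A
  simp only [LinearMap.add_apply, lindbladian_apply, Fintype.sum_sum_type, Sum.elim_inl,
    Sum.elim_inr, add_mul, mul_add, smul_sub, smul_add]
  abel

theorem lindbladian_comp_equiv (H : 𝔄) (K : ι → 𝔄) (e : κ ≃ ι) :
    lindbladian H (K ∘ e) = lindbladian H K := by
  simp only [lindbladian, Function.comp_apply]
  rw [e.sum_comp fun j => LinearMap.mulLeftRight ℂ (star (K j), K j) -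
      (1 / 2 : ℂ) • (LinearMap.mulLeftRight ℂ (star (K j) * K j, 1) +
        LinearMap.mulLeftRight ℂ (1, star (K j) * K j))]

theorem lindbladian_apply_eq_zero_of_commute (φ : 𝔅 →⋆ₐ[ℂ] 𝔄) (H : 𝔅) (K : ι → 𝔅) {A : 𝔄}
    (hA : ∀ b, Commute (φ b) A) : lindbladian (φ H) (φ ∘ K) A = 0 := by
  have anticomm (b : 𝔅) : φ b * A + A * φ b = (2 : ℂ) • (φ b * A) := by
    rw [← (hA b).eq, two_smul]
  have jump (b : 𝔅) : φ (star b) * A * φ b = φ (star b * b) * A := by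
    rw [mul_assoc, ← (hA b).eq, ← mul_assoc, ← map_mul]
  simp only [lindbladian_apply, Function.comp_apply, ← map_star, jump, ← map_mul, anticomm,
    (hA H).eq, sub_self, smul_zero, zero_add, smul_smul]
  norm_num

theorem commute_lindbladian (φ : 𝔅 →⋆ₐ[ℂ] 𝔄) (H : 𝔅) (K : ι → 𝔅) {T : Module.End ℂ 𝔄}
    (hT : ∀ b b', Commute T (LinearMap.mulLeftRight ℂ (φ b, φ b'))) :
    Commute T (lindbladian (φ H) (φ ∘ K)) := by
  have left (b : 𝔅) := hT b 1
  have right (b : 𝔅) := hT 1 b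
  simp only [map_one] at left right
  simp only [lindbladian, Function.comp_apply, ← map_star, ← map_mul]
  exact .add_right (.smul_right (.sub_right (left H) (right H)) _) <| .sum_right _ _ _ fun j _ =>
    .sub_right (hT _ _) (.smul_right (.add_right (left _) (right _)) _)

end Lindbladian

section IsLindblad

variable {m ι : Type*} [Fintype m]

theorem isLindblad_lindbladian [DecidableEq m] [Fintype ι] {H : Matrix m m ℂ} (hH : IsSelfAdjoint H)
    (K : ι → Matrix m m ℂ) : IsLindblad (lindbladian H K) :=
  ⟨H, _, K ∘ (Fintype.equivFin ι).symm, hH, fun A => by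
    rw [← lindbladian_apply, lindbladian_comp_equiv]⟩

theorem IsLindblad.exists_eq_lindbladian [DecidableEq m] {Φ : Matrix m m ℂ →ₗ[ℂ] Matrix m m ℂ}
    (hΦ : IsLindblad Φ) : ∃ (H : Matrix m m ℂ) (ℓ : ℕ) (K : Fin ℓ → Matrix m m ℂ),
      IsSelfAdjoint H ∧ Φ = lindbladian H K := by
  obtain ⟨H, ℓ, K, hH, hΦ⟩ := hΦ
  exact ⟨H, ℓ, K, hH, LinearMap.ext fun A => by rw [hΦ, lindbladian_apply]⟩

theorem isLindblad_sum (s : Finset ι) {Φ : ι → Matrix m m ℂ →ₗ[ℂ] Matrix m m ℂ}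
    (hΦ : ∀ i ∈ s, IsLindblad (Φ i)) : IsLindblad (∑ i ∈ s, Φ i) := by
  classical
  refine Finset.sum_induction Φ IsLindblad (fun Ψ Ψ' hΨ hΨ' => ?_) ?_ hΦ
  · obtain ⟨H, ℓ, K, hH, rfl⟩ := hΨ.exists_eq_lindbladian
    obtain ⟨H', ℓ', K', hH', rfl⟩ := hΨ'.exists_eq_lindbladian
    rw [lindbladian_add]
    exact isLindblad_lindbladian (hH.add hH') _
  · exact ⟨0, 0, Fin.elim0, .zero _, fun A => by simp⟩

end IsLindblad

/-! ### Local algebras -/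

theorem ampliation_reindex {m κ κ' : Type*} (e : κ' ≃ κ)
    (Φ : Matrix m m ℂ →ₗ[ℂ] Matrix m m ℂ) (M : Matrix (m × κ) (m × κ) ℂ) :
    ampliation κ Φ M = Matrix.reindex ((Equiv.refl m).prodCongr e) ((Equiv.refl m).prodCongr e)
      (ampliation κ' Φ (Matrix.reindex ((Equiv.refl m).prodCongr e).symm
        ((Equiv.refl m).prodCongr e).symm M)) := by
  ext
  simp [ampliation]

section Kronecker

variable {m κ : Type*} [Fintype m] [DecidableEq m] [Fintype κ] [DecidableEq κ]

/-- Relabelling the basis, as an isomorphism of ⋆-algebras. -/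
def reindexStarAlgEquiv {n : Type*} [Fintype n] [DecidableEq n] (e : m ≃ n) :
    Matrix m m ℂ ≃⋆ₐ[ℂ] Matrix n n ℂ :=
  .ofAlgEquiv (Matrix.reindexAlgEquiv ℂ ℂ e) fun M => (Matrix.conjTranspose_reindex e e M).symm

theorem norm_reindex {n : Type*} [Fintype n] [DecidableEq n] (e : m ≃ n) (M : Matrix m m ℂ) :
    ‖Matrix.reindex e e M‖ = ‖M‖ :=
  NonUnitalStarAlgHom.norm_map (reindexStarAlgEquiv e) (reindexStarAlgEquiv e).injective M

/-- The inclusion `A ↦ A ⊗ 1` of `B(ℂ^m)` into `B(ℂ^m) ⊗ B(ℂ^κ)`. -/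
def kroneckerOne (m κ : Type*) [Fintype m] [DecidableEq m] [Fintype κ] [DecidableEq κ] :
    Matrix m m ℂ →⋆ₐ[ℂ] Matrix (m × κ) (m × κ) ℂ where
  toFun A := A ⊗ₖ 1
  map_one' := Matrix.one_kronecker_one
  map_mul' A B := by rw [← Matrix.mul_kronecker_mul, mul_one]
  map_zero' := Matrix.zero_kronecker 1
  map_add' A B := Matrix.add_kronecker A B 1
  commutes' c := by
    simp only [Algebra.algebraMap_eq_smul_one, Matrix.smul_kronecker, Matrix.one_kronecker_one]
  map_star' A := by
    simp only [Matrix.star_eq_conjTranspose, Matrix.conjTranspose_kronecker,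
      Matrix.conjTranspose_one]

theorem kronecker_one_commute (A : Matrix m m ℂ) (B : Matrix κ κ ℂ) :
    Commute (A ⊗ₖ (1 : Matrix κ κ ℂ)) ((1 : Matrix m m ℂ) ⊗ₖ B) := by
  simp only [Commute, SemiconjBy, ← Matrix.mul_kronecker_mul, mul_one, one_mul]

theorem ampliation_mulLeftRight (P Q : Matrix m m ℂ) :
    ampliation κ (LinearMap.mulLeftRight ℂ (P, Q)) =
      LinearMap.mulLeftRight ℂ (kroneckerOne m κ P, kroneckerOne m κ Q) := by
  ext1 M
  ext ⟨a, i⟩ ⟨b, j⟩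
  simp [ampliation, kroneckerOne, Matrix.mul_apply, Fintype.sum_prod_type, Matrix.one_apply]

theorem enorm_ampliation_le (Φ : Matrix m m ℂ →ₗ[ℂ] Matrix m m ℂ) :
    ‖LinearMap.toContinuousLinearMap (ampliation κ Φ)‖ₑ ≤ cbNorm Φ := by
  refine le_trans ?_ (le_iSup _ (Fintype.card κ))
  refine enorm_le_iff_norm_le.2 (ContinuousLinearMap.opNorm_le_bound _ (norm_nonneg _) fun M => ?_)
  rw [LinearMap.coe_toContinuousLinearMap', ampliation_reindex (Fintype.equivFin κ).symm,
    norm_reindex]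
  refine ((LinearMap.toContinuousLinearMap
    (ampliation (Fin (Fintype.card κ)) Φ)).le_opNorm _).trans_eq ?_
  rw [norm_reindex]

end Kronecker

section LocalAlgebra

variable {Γ : Type*} [DecidableEq Γ] {q : Γ → ℕ} {Z Z' X Y Λ : Finset Γ}

theorem embed_apply (h : Z ⊆ Λ) (A : Obs q Z) (σ τ : Conf q Λ) :
    embed q h A σ τ = if ∀ x : Λ, x.1 ∉ Z → σ x = τ x then
      A (fun x => σ ⟨x, h x.2⟩) (fun x => τ ⟨x, h x.2⟩) else 0 := by
  change A _ _ * (1 : Obs q (Λ \ Z)) (splitConf q h σ).2 (splitConf q h τ).2 = _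
  rw [Matrix.one_apply, mul_ite, mul_one, mul_zero]
  exact if_congr (funext_iff.trans ⟨fun off x hxZ => off ⟨x, Finset.mem_sdiff.2 ⟨x.2, hxZ⟩⟩,
    fun off x => off _ (Finset.mem_sdiff.1 x.2).2⟩) rfl rfl

theorem embed_trans (h : Z ⊆ Y) (h' : Y ⊆ Λ) (A : Obs q Z) :
    embed q h' (embed q h A) = embed q (h.trans h') A := by
  ext σ τ
  simp only [embed_apply, ← ite_and, Subtype.forall]
  refine if_congr ⟨fun ⟨offY, offZ⟩ x hx hxZ => ?_, fun offZ =>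
    ⟨fun x hx hxY => offZ x hx fun hxZ => hxY (h hxZ), fun x hx => offZ x (h' hx)⟩⟩ rfl rfl
  by_cases hxY : x ∈ Y
  exacts [offZ x hxY hxZ, offY x hx hxY]

theorem embed_eq_one_kronecker (h : Z ⊆ Λ) (h' : Z' ⊆ Λ \ Z) (A : Obs q Z') :
    embed q (h'.trans Finset.sdiff_subset) A =
      reindexStarAlgEquiv (splitConf q h).symm ((1 : Obs q Z) ⊗ₖ embed q h' A) := by
  ext σ τ
  change _ = ((1 : Obs q Z) ⊗ₖ embed q h' A) (splitConf q h σ) (splitConf q h τ)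
  simp only [Matrix.kroneckerMap_apply, embed_apply, Matrix.one_apply, ite_mul, one_mul, zero_mul,
    ← ite_and, splitConf, Equiv.coe_fn_mk, funext_iff, Subtype.forall]
  refine if_congr ⟨fun offZ' => ⟨fun x hx => offZ' x (h hx) fun hxZ' =>
    (Finset.mem_sdiff.1 (h' hxZ')).2 hx, fun x hx => offZ' x (Finset.sdiff_subset hx)⟩,
    fun ⟨onZ, offZ'⟩ x hx hxZ' => ?_⟩ rfl rfl
  by_cases hxZ : x ∈ Z
  exacts [onZ x hxZ, offZ' x (Finset.mem_sdiff.2 ⟨hx, hxZ⟩) hxZ']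

theorem embed_commute (h : Z ⊆ Λ) (h' : Z' ⊆ Λ) (hd : Disjoint Z Z') (A : Obs q Z)
    (B : Obs q Z') : Commute (embed q h A) (embed q h' B) := by
  have hZ' : Z' ⊆ Λ \ Z := Finset.subset_sdiff.2 ⟨h', hd.symm⟩
  rw [embed_eq_one_kronecker h hZ']
  exact (kronecker_one_commute A (embed q hZ' B)).map (reindexStarAlgEquiv (splitConf q h).symm)

/-- The inclusion `A_Z ⊆ A_Λ` as a homomorphism of unital ⋆-algebras. -/
def embedHom (q : Γ → ℕ) (h : Z ⊆ Λ) : Obs q Z →⋆ₐ[ℂ] Obs q Λ :=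
  (reindexStarAlgEquiv (splitConf q h).symm).toStarAlgHom.comp (kroneckerOne _ _)

theorem embedHom_apply (h : Z ⊆ Λ) (A : Obs q Z) : embedHom q h A = embed q h A := rfl

theorem norm_embed_le (h : Z ⊆ Λ) (A : Obs q Z) : ‖embed q h A‖ ≤ ‖A‖ :=
  NonUnitalStarAlgHom.norm_apply_le (embedHom q h) A

theorem extend_mulLeftRight (h : Z ⊆ Λ) (P Q : Obs q Z) :
    extend q h (LinearMap.mulLeftRight ℂ (P, Q)) =
      LinearMap.mulLeftRight ℂ (embedHom q h P, embedHom q h Q) := by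
  let ρ := reindexStarAlgEquiv (splitConf q h).symm
  ext1 M
  change ρ (ampliation _ (LinearMap.mulLeftRight ℂ (P, Q)) (ρ.symm M)) = _
  rw [ampliation_mulLeftRight, LinearMap.mulLeftRight_apply, map_mul, map_mul,
    StarAlgEquiv.apply_symm_apply]
  rfl

/-- `Φ ↦ Φ ⊗ id_{Λ ∖ Z}` as a linear map. -/
def extendLin (q : Γ → ℕ) (h : Z ⊆ Λ) :
    (Obs q Z →ₗ[ℂ] Obs q Z) →ₗ[ℂ] Obs q Λ →ₗ[ℂ] Obs q Λ where
  toFun := extend q h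
  map_add' _ _ := rfl
  map_smul' _ _ := rfl

theorem extendLin_apply (h : Z ⊆ Λ) (Φ : Obs q Z →ₗ[ℂ] Obs q Z) :
    extendLin q h Φ = extend q h Φ := rfl

theorem extend_lindbladian {ι : Type*} [Fintype ι] (h : Z ⊆ Λ) (H : Obs q Z) (K : ι → Obs q Z) :
    extend q h (lindbladian H K) = lindbladian (embedHom q h H) (embedHom q h ∘ K) := by
  rw [← extendLin_apply, lindbladian]
  simp only [map_add, map_smul, map_sub, map_sum, extendLin_apply, extend_mulLeftRight, map_mul,
    map_one, map_star, lindbladian, Function.comp_apply]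

theorem isLindblad_extend (h : Z ⊆ Λ) {Φ : Obs q Z →ₗ[ℂ] Obs q Z} (hΦ : IsLindblad Φ) :
    IsLindblad (extend q h Φ) := by
  obtain ⟨H, ℓ, K, hH, rfl⟩ := hΦ.exists_eq_lindbladian
  rw [extend_lindbladian]
  exact isLindblad_lindbladian (hH.map (embedHom q h)) _

theorem embed_extend (h : Z ⊆ Y) (h' : Y ⊆ Λ) {Φ : Obs q Z →ₗ[ℂ] Obs q Z} (hΦ : IsLindblad Φ)
    (A : Obs q Y) : embed q h' (extend q h Φ A) = extend q (h.trans h') Φ (embed q h' A) := by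
  obtain ⟨H, ℓ, K, -, rfl⟩ := hΦ.exists_eq_lindbladian
  rw [extend_lindbladian, extend_lindbladian, ← embedHom_apply, map_lindbladian]
  simp only [Function.comp_def, embedHom_apply, embed_trans]

theorem extend_embed_of_disjoint (h : Z ⊆ Λ) (hX : X ⊆ Λ) (hd : Disjoint Z X)
    {Φ : Obs q Z →ₗ[ℂ] Obs q Z} (hΦ : IsLindblad Φ) (A : Obs q X) :
    extend q h Φ (embed q hX A) = 0 := by
  obtain ⟨H, ℓ, K, -, rfl⟩ := hΦ.exists_eq_lindbladian
  rw [extend_lindbladian]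
  exact lindbladian_apply_eq_zero_of_commute _ H K fun B => embed_commute h hX hd B A

theorem extend_commute (h : Z ⊆ Λ) (h' : Z' ⊆ Λ) (hd : Disjoint Z Z')
    {Φ : Obs q Z →ₗ[ℂ] Obs q Z} (hΦ : IsLindblad Φ)
    {Ψ : Obs q Z' →ₗ[ℂ] Obs q Z'} (hΨ : IsLindblad Ψ) :
    Commute (extend q h Φ : Module.End ℂ (Obs q Λ)) (extend q h' Ψ) := by
  obtain ⟨H, ℓ, K, -, rfl⟩ := hΦ.exists_eq_lindbladian
  obtain ⟨H', ℓ', K', -, rfl⟩ := hΨ.exists_eq_lindbladian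
  rw [extend_lindbladian, extend_lindbladian]
  refine commute_lindbladian _ H' K' fun B B' => Commute.symm ?_
  exact commute_lindbladian _ H K fun A A' => commute_mulLeftRight
    (embed_commute h h' hd A B).symm (embed_commute h h' hd A' B').symm

theorem enorm_extend_le (h : Z ⊆ Λ) (Φ : Obs q Z →ₗ[ℂ] Obs q Z) :
    ‖LinearMap.toContinuousLinearMap (extend q h Φ)‖ₑ ≤ cbNorm Φ := by
  refine le_trans ?_ (enorm_ampliation_le (κ := Conf q (Λ \ Z)) Φ)
  refine enorm_le_iff_norm_le.2 (ContinuousLinearMap.opNorm_le_bound _ (norm_nonneg _) fun M => ?_)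
  change ‖Matrix.reindex (splitConf q h).symm (splitConf q h).symm (LinearMap.toContinuousLinearMap
    (ampliation _ Φ) (Matrix.reindex (splitConf q h) (splitConf q h) M))‖ ≤ _
  rw [norm_reindex, ← norm_reindex (splitConf q h) M]
  exact ContinuousLinearMap.le_opNorm _ _

end LocalAlgebra

/-! ### Dissipativity -/

/-- Dissipativity in the sense of Lumer and Phillips, for a possibly nonlinear map. -/
def IsDissipative {E : Type*} [NormedAddCommGroup E] [NormedSpace ℝ E] (G : E → E) : Prop :=
  ∀ (B : E) (h : ℝ), 0 ≤ h → ‖B‖ ≤ ‖B - h • G B‖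

section HilbertSpace

open ContinuousLinearMap
open scoped InnerProductSpace

variable {𝓗 ι : Type*} [NormedAddCommGroup 𝓗] [InnerProductSpace ℂ 𝓗]

theorem exists_norm_apply_eq_norm [FiniteDimensional ℂ 𝓗] [Nontrivial 𝓗] (A : 𝓗 →L[ℂ] 𝓗) :
    ∃ ψ, ‖ψ‖ = 1 ∧ ‖A ψ‖ = ‖A‖ := by
  have : ProperSpace 𝓗 := FiniteDimensional.proper ℂ 𝓗
  obtain ⟨ψ, hψ, hmax⟩ := (isCompact_sphere (0 : 𝓗) 1).exists_isMaxOn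
    (NormedSpace.sphere_nonempty.2 zero_le_one) A.continuous.norm.continuousOn
  have norm_ψ : ‖ψ‖ = 1 := by simpa using hψ
  refine ⟨ψ, norm_ψ, le_antisymm (A.unit_le_opNorm ψ norm_ψ.le) ?_⟩
  exact A.opNorm_le_of_unit_norm (norm_nonneg _) fun x hx => hmax (by simpa using hx)

theorem isDissipative_of_re_inner_nonpos [FiniteDimensional ℂ 𝓗] {G : (𝓗 →L[ℂ] 𝓗) → (𝓗 →L[ℂ] 𝓗)}
    (hG : ∀ A ψ, ‖ψ‖ = 1 → ‖A ψ‖ = ‖A‖ → (⟪A ψ, G A ψ⟫_ℂ).re ≤ 0) : IsDissipative G := by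
  intro A h hh
  cases subsingleton_or_nontrivial 𝓗
  · simp [Subsingleton.elim A 0]
  obtain ⟨ψ, norm_ψ, norm_Aψ⟩ := exists_norm_apply_eq_norm A
  refine (norm_nonneg A).eq_or_lt.elim (fun h0 => h0 ▸ norm_nonneg _) fun h0 =>
    le_of_mul_le_mul_left ?_ h0
  calc ‖A‖ * ‖A‖ ≤ ‖A‖ * ‖A‖ - h * (⟪A ψ, G A ψ⟫_ℂ).re := by
        linarith [mul_nonpos_of_nonneg_of_nonpos hh (hG A ψ norm_ψ norm_Aψ)]
    _ = (⟪A ψ, (A - h • G A) ψ⟫_ℂ).re := by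
        have inner_self : (⟪A ψ, A ψ⟫_ℂ).re = ‖A‖ * ‖A‖ := by
          rw [← norm_Aψ]
          exact inner_self_eq_norm_mul_norm (𝕜 := ℂ) (A ψ)
        rw [sub_apply, smul_apply, inner_sub_right, inner_smul_right_eq_smul, Complex.sub_re,
          Complex.smul_re, smul_eq_mul, inner_self]
    _ ≤ ‖A ψ‖ * ‖(A - h • G A) ψ‖ := re_inner_le_norm (𝕜 := ℂ) _ _
    _ ≤ ‖A‖ * ‖A - h • G A‖ := by
        rw [norm_Aψ]
        gcongr
        exact unit_le_opNorm _ ψ norm_ψ.le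

variable [CompleteSpace 𝓗]

theorem adjoint_apply_apply_of_norm_eq {A : 𝓗 →L[ℂ] 𝓗} {ψ : 𝓗} (norm_ψ : ‖ψ‖ = 1)
    (norm_Aψ : ‖A ψ‖ = ‖A‖) : adjoint A (A ψ) = ((‖A‖ ^ 2 : ℝ) : ℂ) • ψ := by
  have inner_eq : ⟪adjoint A (A ψ), ψ⟫_ℂ = ((‖A‖ ^ 2 : ℝ) : ℂ) := by
    rw [adjoint_inner_left, inner_self_eq_norm_sq_to_K, norm_Aψ]
    norm_cast
  have norm_eq : ‖adjoint A (A ψ)‖ = ‖A‖ ^ 2 := by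
    refine le_antisymm ?_ ?_
    · refine ((adjoint A).le_opNorm _).trans_eq ?_
      rw [LinearIsometryEquiv.norm_map, norm_Aψ, sq]
    · have := norm_inner_le_norm (𝕜 := ℂ) (adjoint A (A ψ)) ψ
      rwa [inner_eq, norm_ψ, mul_one, Complex.norm_of_nonneg (sq_nonneg _)] at this
  have := inner_eq_norm_mul_iff (𝕜 := ℂ) (x := adjoint A (A ψ)) (y := ψ)
  rw [norm_eq, norm_ψ, inner_eq] at this
  simpa using this

theorem re_inner_commutator_eq_zero {A H : 𝓗 →L[ℂ] 𝓗} (hH : IsSelfAdjoint H) {ψ : 𝓗} {c : ℝ}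
    (hψ : adjoint A (A ψ) = (c : ℂ) • ψ) :
    (⟪A ψ, (Complex.I • (H * A - A * H)) ψ⟫_ℂ).re = 0 := by
  have im_inner (x : 𝓗) : (⟪x, H x⟫_ℂ).im = 0 := hH.isSymmetric.im_inner_self_apply x
  rw [smul_apply, sub_apply, mul_apply_eq_comp, mul_apply_eq_comp, inner_smul_right,
    inner_sub_right, ← adjoint_inner_left A, hψ, inner_smul_left, Complex.conj_ofReal,
    Complex.I_mul_re, Complex.sub_im, Complex.im_ofReal_mul, im_inner, im_inner, mul_zero,
    sub_zero, neg_zero]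

theorem re_inner_jump_nonpos {A : 𝓗 →L[ℂ] 𝓗} (K : 𝓗 →L[ℂ] 𝓗) {ψ : 𝓗}
    (hψ : adjoint A (A ψ) = ((‖A‖ ^ 2 : ℝ) : ℂ) • ψ) :
    (⟪A ψ, (star K * A * K -
      (1 / 2 : ℂ) • (star K * K * A + A * (star K * K))) ψ⟫_ℂ).re ≤ 0 := by
  have inner_apply (y : 𝓗) : ⟪A ψ, A y⟫_ℂ = ((‖A‖ ^ 2 : ℝ) : ℂ) * ⟪ψ, y⟫_ℂ := by
    rw [← adjoint_inner_left, hψ, inner_smul_left, Complex.conj_ofReal]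
  have inner_eq :
      ⟪A ψ, (star K * A * K - (1 / 2 : ℂ) • (star K * K * A + A * (star K * K))) ψ⟫_ℂ =
      ⟪K (A ψ), A (K ψ)⟫_ℂ -
        ((1 / 2 * (‖K (A ψ)‖ ^ 2 + ‖A‖ ^ 2 * ‖K ψ‖ ^ 2) : ℝ) : ℂ) := by
    simp only [star_eq_adjoint, sub_apply, smul_apply, add_apply, mul_apply_eq_comp,
      inner_sub_right, inner_smul_right, inner_add_right, inner_apply, adjoint_inner_right,
      inner_self_eq_norm_sq_to_K]
    push_cast
    rfl
  rw [inner_eq, Complex.sub_re, Complex.ofReal_re, sub_nonpos]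
  calc (⟪K (A ψ), A (K ψ)⟫_ℂ).re ≤ ‖K (A ψ)‖ * ‖A (K ψ)‖ := re_inner_le_norm (𝕜 := ℂ) _ _
    _ ≤ ‖K (A ψ)‖ * (‖A‖ * ‖K ψ‖) := by gcongr; exact A.le_opNorm _
    _ ≤ 1 / 2 * (‖K (A ψ)‖ ^ 2 + ‖A‖ ^ 2 * ‖K ψ‖ ^ 2) := by
        linarith [two_mul_le_add_sq ‖K (A ψ)‖ (‖A‖ * ‖K ψ‖), mul_pow ‖A‖ ‖K ψ‖ 2]

theorem isDissipative_lindbladian [FiniteDimensional ℂ 𝓗] [Fintype ι] {H : 𝓗 →L[ℂ] 𝓗}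
    (hH : IsSelfAdjoint H) (K : ι → 𝓗 →L[ℂ] 𝓗) : IsDissipative (lindbladian H K) := by
  refine isDissipative_of_re_inner_nonpos fun A ψ norm_ψ norm_Aψ => ?_
  have hψ := adjoint_apply_apply_of_norm_eq norm_ψ norm_Aψ
  rw [lindbladian_apply, add_apply, sum_apply, inner_add_right, inner_sum, Complex.add_re,
    Complex.re_sum, re_inner_commutator_eq_zero hH hψ, zero_add]
  exact Finset.sum_nonpos fun j _ => re_inner_jump_nonpos (K j) hψ

end HilbertSpace

theorem IsLindblad.isDissipative {m : Type*} [Fintype m] [DecidableEq m]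
    {Φ : Matrix m m ℂ →ₗ[ℂ] Matrix m m ℂ} (hΦ : IsLindblad Φ) : IsDissipative Φ := by
  obtain ⟨H, ℓ, K, hH, rfl⟩ := hΦ.exists_eq_lindbladian
  let ρ := (Matrix.toEuclideanCLM (n := m) (𝕜 := ℂ)).toStarAlgHom
  intro B h hh
  have := isDissipative_lindbladian (hH.map ρ) (ρ ∘ K) (ρ B) h hh
  rw [← map_lindbladian, ← Complex.coe_smul h, ← map_smul, ← map_sub, Complex.coe_smul] at this
  exact this

section Duhamel

open Filter

variable {E : Type*} [NormedAddCommGroup E] [NormedSpace ℝ E] {G : E → E} {u f : ℝ → E}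

/- Dissipativity controls an implicit (backward) Euler step, so it is applied to the solution run
backwards in time. -/
theorem IsDissipative.frequently_slope_norm_lt (hG : IsDissipative G) {f₀ : E} {t x r : ℝ}
    (hu : HasDerivAt u (G (u (t - x)) + f₀) (t - x)) (hr : ‖f₀‖ < r) :
    ∃ᶠ z in nhdsWithin x (Set.Ioi x), slope (fun s => -‖u (t - s)‖) x z < r := by
  refine Eventually.frequently ?_
  have hv : HasDerivAt (fun s => u (t - s)) (-(G (u (t - x)) + f₀)) x := hu.comp_const_sub t x
  have hr' : 0 < (r - ‖f₀‖) / 2 := half_pos (sub_pos.2 hr)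
  have little_o := ((hasDerivAt_iff_isLittleO.1 hv).def hr').filter_mono
    (nhdsWithin_le_nhds (s := Set.Ioi x))
  filter_upwards [little_o, self_mem_nhdsWithin] with z remainder_le hxz
  have step_pos : 0 < z - x := sub_pos.2 hxz
  rw [Real.norm_of_nonneg step_pos.le] at remainder_le
  rw [slope_def_field, div_lt_iff₀ step_pos]
  have norm_le : ‖u (t - x)‖ ≤ ‖u (t - z)‖ + ‖(z - x) • f₀‖ +
      ‖u (t - z) - u (t - x) - (z - x) • -(G (u (t - x)) + f₀)‖ := by
    calc ‖u (t - x)‖ ≤ ‖u (t - x) - (z - x) • G (u (t - x))‖ := hG _ _ step_pos.le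
      _ = ‖u (t - z) + (z - x) • f₀ -
          (u (t - z) - u (t - x) - (z - x) • -(G (u (t - x)) + f₀))‖ := by
        congr 1
        module
      _ ≤ _ := (norm_sub_le _ _).trans (by gcongr; exact norm_add_le _ _)
  rw [norm_smul, Real.norm_of_nonneg step_pos.le] at norm_le
  nlinarith [mul_pos (sub_pos.2 hr) step_pos]

theorem IsDissipative.norm_le_of_hasDerivAt (hG : IsDissipative G) {b b' : ℝ → ℝ}
    (hu : ∀ s, HasDerivAt u (G (u s) + f s) s) (hb : ∀ s, HasDerivAt b (b' s) s)
    (h0 : ‖u 0‖ ≤ b 0) (hf : ∀ s, 0 ≤ s → ‖f s‖ ≤ b' s) {t : ℝ} (ht : 0 ≤ t) : ‖u t‖ ≤ b t := by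
  have reversed_continuous : Continuous fun s => u (t - s) :=
    (continuous_iff_continuousAt.2 fun s => (hu s).continuousAt).comp (continuous_const.sub
      continuous_id)
  have bound_hasDerivAt (s : ℝ) :
      HasDerivAt (fun s => -‖u t‖ + (b t - b (t - s))) (b' (t - s)) s := by
    simpa using (((hb (t - s)).comp_const_sub t s).const_sub (b t)).const_add (-‖u t‖)
  have key := image_le_of_liminf_slope_right_le_deriv_boundary (f := fun s => -‖u (t - s)‖)
    (a := 0) (b := t) reversed_continuous.norm.neg.continuousOn (by simp)
    (HasDerivAt.continuousOn fun s _ => bound_hasDerivAt s)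
    (fun s _ => (bound_hasDerivAt s).hasDerivWithinAt)
    (fun s hs r hr => hG.frequently_slope_norm_lt (hu (t - s))
      ((hf _ (sub_nonneg.2 hs.2.le)).trans_lt hr)) (Set.right_mem_Icc.2 ht)
  rw [sub_self] at key
  linarith

end Duhamel

section Exponential

theorem hasDerivAt_exp_smul_apply {E : Type*} [NormedAddCommGroup E] [NormedSpace ℂ E]
    [CompleteSpace E] (G : E →L[ℂ] E) (A : E) (t : ℝ) :
    HasDerivAt (fun s : ℝ => NormedSpace.exp ((s : ℂ) • G) A)
      (G (NormedSpace.exp ((t : ℂ) • G) A)) t := by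
  have exp_deriv := (hasDerivAt_exp_smul_const' (𝕂 := ℂ) G (t : ℂ)).scomp t
    Complex.ofRealCLM.hasDerivAt
  simp only [Complex.ofRealCLM_apply, Complex.ofReal_one, one_smul] at exp_deriv
  exact ((ContinuousLinearMap.apply ℂ E A).restrictScalars ℝ).hasFDerivAt.comp_hasDerivAt t
    exp_deriv

theorem exp_zero_smul_apply {E : Type*} [NormedAddCommGroup E] [NormedSpace ℂ E]
    (G : E →L[ℂ] E) (A : E) : NormedSpace.exp (((0 : ℝ) : ℂ) • G) A = A := by
  rw [Complex.ofReal_zero, zero_smul, NormedSpace.exp_zero, one_apply_eq_self]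

/-- The growth function `M ∫₀ᵗ e^{MCs} ds`, which solves `κ' = M (1 + C κ)`, `κ 0 = 0`. It equals
`(e^{MCt} - 1) / C` when `C ≠ 0`; the integral also covers `C = 0`. -/
def lrGrowth (M C t : ℝ) : ℝ := M * ∫ s in (0 : ℝ)..t, Real.exp (M * C * s)

theorem lrGrowth_zero (M C : ℝ) : lrGrowth M C 0 = 0 := by
  rw [lrGrowth, intervalIntegral.integral_same, mul_zero]

theorem lrGrowth_nonneg {M t : ℝ} (hM : 0 ≤ M) (ht : 0 ≤ t) (C : ℝ) : 0 ≤ lrGrowth M C t :=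
  mul_nonneg hM (intervalIntegral.integral_nonneg ht fun _ _ => (Real.exp_pos _).le)

theorem one_add_mul_lrGrowth (M C t : ℝ) : 1 + C * lrGrowth M C t = Real.exp (M * C * t) := by
  have hderiv (s : ℝ) : HasDerivAt (fun s => Real.exp (M * C * s))
      (C * M * Real.exp (M * C * s)) s := by
    simpa [mul_comm, mul_left_comm] using ((hasDerivAt_id s).const_mul (M * C)).exp
  have hint := intervalIntegral.integral_eq_sub_of_hasDerivAt (a := 0) (b := t)
    (fun s _ => hderiv s) (Continuous.intervalIntegrable (by fun_prop) _ _)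
  rw [intervalIntegral.integral_const_mul, mul_zero, Real.exp_zero] at hint
  rw [lrGrowth, ← mul_assoc, hint]
  ring

theorem hasDerivAt_lrGrowth (M C t : ℝ) :
    HasDerivAt (lrGrowth M C) (M * (1 + C * lrGrowth M C t)) t := by
  rw [one_add_mul_lrGrowth]
  have hcont : Continuous fun s => Real.exp (M * C * s) := by fun_prop
  exact (hcont.integral_hasStrictDerivAt 0 t).hasDerivAt.const_mul M

end Exponential

/-! ### Lieb–Robinson bounds -/

section Weights

open Finset

variable {Γ : Type*} [DecidableEq Γ] {f : Γ → Γ → ℝ} {a : Finset Γ → ℝ} {Λ X Y Z : Finset Γ}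
  {M C κ : ℝ}

/-- The weights `a Z` of the subsets of `Λ` decay with rate `M` relative to the kernel `f`, which
satisfies a convolution inequality with constant `C`. In the application `a Z` is the norm of a
local term of the generator and `f x y = F (dist x y)`. -/
structure HasDecay (f : Γ → Γ → ℝ) (a : Finset Γ → ℝ) (Λ : Finset Γ) (M C : ℝ) : Prop where
  kernel_nonneg : ∀ x y, 0 ≤ f x y
  weight_nonneg : ∀ Z, 0 ≤ a Z
  rate_nonneg : 0 ≤ M
  conv_le : ∀ x y, ∑ z ∈ Λ, f x z * f z y ≤ C * f x y
  sum_weight_le : ∀ x y, ∑ Z ∈ Λ.powerset with x ∈ Z ∧ y ∈ Z, a Z ≤ M * f x y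

/-- The spatial profile `|X ∩ Z| + κ ∑_{x ∈ X, z ∈ Z} f(x, z)` of a Lieb–Robinson bound, for an
observable initially supported in `X` probed by a local term acting on `Z`. -/
def lrWeight (f : Γ → Γ → ℝ) (X : Finset Γ) (κ : ℝ) (Z : Finset Γ) : ℝ :=
  #(X ∩ Z) + κ * ∑ x ∈ X, ∑ z ∈ Z, f x z

theorem lrWeight_nonneg (hf : ∀ x y, 0 ≤ f x y) (hκ : 0 ≤ κ) : 0 ≤ lrWeight f X κ Z :=
  add_nonneg (Nat.cast_nonneg _)
    (mul_nonneg hκ (sum_nonneg fun _ _ => sum_nonneg fun _ _ => hf _ _))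

theorem one_le_lrWeight_zero (h : ¬Disjoint Z X) : 1 ≤ lrWeight f X 0 Z := by
  rw [lrWeight, zero_mul, add_zero, Nat.one_le_cast, Nat.one_le_iff_ne_zero, inter_comm,
    Ne, card_eq_zero, ← disjoint_iff_inter_eq_empty]
  exact h

theorem sum_filter_not_disjoint_le {g : Finset Γ → ℝ} {P : Finset (Finset Γ)}
    (hg : ∀ Z ∈ P, 0 ≤ g Z) (Y : Finset Γ) :
    ∑ Z ∈ P with ¬Disjoint Z Y, g Z ≤ ∑ y ∈ Y, ∑ Z ∈ P with y ∈ Z, g Z := by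
  simp only [sum_filter]
  rw [sum_comm]
  refine sum_le_sum fun Z hZ => ?_
  have terms_nonneg : ∀ y ∈ Y, 0 ≤ if y ∈ Z then g Z else 0 := fun y _ =>
    ite_nonneg (hg Z hZ) le_rfl
  by_cases h : Disjoint Z Y
  · rw [if_neg (not_not.2 h)]
    exact sum_nonneg terms_nonneg
  · rw [if_pos h]
    obtain ⟨y, hyZ, hyY⟩ := not_disjoint_iff.1 h
    exact (if_pos hyZ).symm.trans_le (single_le_sum terms_nonneg hyY)

theorem HasDecay.sum_mul_sum_inter_le (h : HasDecay f a Λ M C) {c : Γ → ℝ} (hc : ∀ z, 0 ≤ c z)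
    (W : Finset Γ) (y : Γ) :
    ∑ Z ∈ Λ.powerset with y ∈ Z, a Z * ∑ z ∈ W ∩ Z, c z ≤ M * ∑ z ∈ W, c z * f z y := by
  calc ∑ Z ∈ Λ.powerset with y ∈ Z, a Z * ∑ z ∈ W ∩ Z, c z
      = ∑ z ∈ W, c z * ∑ Z ∈ Λ.powerset with z ∈ Z ∧ y ∈ Z, a Z := by
        simp only [← filter_mem_eq_inter, sum_filter, mul_sum]
        rw [sum_comm]
        refine sum_congr rfl fun Z _ => ?_
        by_cases hy : y ∈ Z <;> simp [hy, mul_comm]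
    _ ≤ ∑ z ∈ W, c z * (M * f z y) := by
        gcongr
        · exact hc _
        · exact h.sum_weight_le _ y
    _ = M * ∑ z ∈ W, c z * f z y := by
        rw [mul_sum]
        exact sum_congr rfl fun z _ => mul_left_comm _ _ _

theorem HasDecay.sum_mul_lrWeight_le_of_mem (h : HasDecay f a Λ M C) (X : Finset Γ) (hκ : 0 ≤ κ)
    (y : Γ) :
    ∑ Z ∈ Λ.powerset with y ∈ Z, a Z * lrWeight f X κ Z ≤ M * (1 + C * κ) * ∑ x ∈ X, f x y := by
  have overlap_le := h.sum_mul_sum_inter_le (c := fun _ => 1) (fun _ => zero_le_one) X y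
  have tail_le := h.sum_mul_sum_inter_le (c := fun z => ∑ x ∈ X, f x z)
    (fun z => sum_nonneg fun x _ => h.kernel_nonneg x z) Λ y
  have conv_le : ∑ z ∈ Λ, (∑ x ∈ X, f x z) * f z y ≤ C * ∑ x ∈ X, f x y := by
    simp only [sum_mul, mul_sum]
    rw [sum_comm]
    exact sum_le_sum fun x _ => h.conv_le x y
  have weight_eq : ∀ Z ∈ Λ.powerset.filter (y ∈ ·), a Z * lrWeight f X κ Z =
      a Z * ∑ _z ∈ X ∩ Z, (1 : ℝ) + κ * (a Z * ∑ z ∈ Λ ∩ Z, ∑ x ∈ X, f x z) := fun Z hZ => by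
    rw [inter_eq_right.2 (mem_powerset.1 (mem_filter.1 hZ).1), lrWeight, sum_comm, sum_const,
      nsmul_one]
    ring
  rw [sum_congr rfl weight_eq, sum_add_distrib, ← mul_sum]
  simp only [one_mul] at overlap_le
  calc _ ≤ M * ∑ x ∈ X, f x y + κ * (M * (C * ∑ x ∈ X, f x y)) := by
        gcongr
        exact tail_le.trans (mul_le_mul_of_nonneg_left conv_le h.rate_nonneg)
    _ = M * (1 + C * κ) * ∑ x ∈ X, f x y := by ring

theorem HasDecay.sum_mul_lrWeight_le (h : HasDecay f a Λ M C) (X Y : Finset Γ) (hκ : 0 ≤ κ) :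
    ∑ Z ∈ Λ.powerset with ¬Disjoint Z Y, a Z * lrWeight f X κ Z ≤
      M * (1 + C * κ) * ∑ x ∈ X, ∑ y ∈ Y, f x y := by
  rw [sum_comm, mul_sum]
  exact (sum_filter_not_disjoint_le (fun Z _ => mul_nonneg (h.weight_nonneg Z)
    (lrWeight_nonneg h.kernel_nonneg hκ)) Y).trans
    (sum_le_sum fun y _ => h.sum_mul_lrWeight_le_of_mem X hκ y)

end Weights

section LiebRobinson

open Finset Filter

variable {Γ E : Type*} [NormedAddCommGroup E] [NormedSpace ℝ E]
  {D : Finset Γ → E →L[ℝ] E} {T T' : ℝ → E} {f : Γ → Γ → ℝ} {X Y Z Λ : Finset Γ} {M C t : ℝ}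

/-- A family of local terms `D Z` that commute when their supports `Z` are disjoint and whose
finite partial sums are dissipative, such as the terms of a Lindbladian. -/
structure IsLocalGenerator (D : Finset Γ → E →L[ℝ] E) : Prop where
  commute : ∀ {Z Z' : Finset Γ}, Disjoint Z Z' → Commute (D Z) (D Z')
  isDissipative : ∀ S : Finset (Finset Γ), IsDissipative fun B => ∑ Z ∈ S, D Z B

/-- `T` solves the evolution equation of the volume `Λ`, with generator `∑_{Z ⊆ Λ} D Z`. -/
def IsEvolution (D : Finset Γ → E →L[ℝ] E) (Λ : Finset Γ) (T : ℝ → E) : Prop :=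
  ∀ s, HasDerivAt T (∑ Z ∈ Λ.powerset, D Z (T s)) s

theorem IsLocalGenerator.norm_evolution_le (hD : IsLocalGenerator D) (hT : IsEvolution D Λ T)
    (ht : 0 ≤ t) : ‖T t‖ ≤ ‖T 0‖ :=
  (hD.isDissipative Λ.powerset).norm_le_of_hasDerivAt (f := 0) (b := fun _ => ‖T 0‖) (b' := 0)
    (fun s => by simpa using hT s) (fun s => hasDerivAt_const s _) le_rfl
    (fun _ _ => norm_zero.le) ht

variable [DecidableEq Γ]

/-- The Lieb–Robinson bound on `‖D Z (T s)‖` for `T 0` supported in `X`, up to an error of size `c`.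
The growth rate of the error is chosen so that inserting the bound into the evolution equation
halves `c`. -/
def LiebRobinsonUpTo (c : ℝ) (D : Finset Γ → E →L[ℝ] E) (T : ℝ → E) (f : Γ → Γ → ℝ)
    (X Λ : Finset Γ) (M C : ℝ) : Prop :=
  ∀ Z s, 0 ≤ s → ‖D Z (T s)‖ ≤ ‖D Z‖ * (‖T 0‖ * lrWeight f X (lrGrowth M C s) Z +
    c * Real.exp (2 * (∑ Z' ∈ Λ.powerset, ‖D Z'‖) * s))

theorem IsLocalGenerator.norm_apply_le_of_hasDerivAt (hD : IsLocalGenerator D)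
    (hT : IsEvolution D Λ T) {b b' : ℝ → ℝ} (hb : ∀ s, HasDerivAt b (b' s) s)
    (h0 : ‖D Z (T 0)‖ ≤ b 0)
    (hmeet : ∀ s, 0 ≤ s →
      ‖D Z‖ * ∑ Z' ∈ Λ.powerset with ¬Disjoint Z' Z, ‖D Z' (T s)‖ ≤ b' s)
    (ht : 0 ≤ t) : ‖D Z (T t)‖ ≤ b t := by
  have split_generator (s : ℝ) : D Z (∑ Z' ∈ Λ.powerset, D Z' (T s)) =
      ∑ Z' ∈ Λ.powerset with Disjoint Z' Z, D Z' (D Z (T s)) +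
        D Z (∑ Z' ∈ Λ.powerset with ¬Disjoint Z' Z, D Z' (T s)) := by
    rw [← sum_filter_add_sum_filter_not Λ.powerset (Disjoint · Z), map_add, map_sum]
    congr 1
    exact sum_congr rfl fun Z' hZ' =>
      DFunLike.congr_fun (hD.commute (mem_filter.1 hZ').2.symm).eq (T s)
  refine (hD.isDissipative (Λ.powerset.filter (Disjoint · Z))).norm_le_of_hasDerivAt
    (u := fun s => D Z (T s)) (fun s => ?_) hb h0 (fun s hs => ?_) ht
    (f := fun s => D Z (∑ Z' ∈ Λ.powerset with ¬Disjoint Z' Z, D Z' (T s)))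
  · rw [← split_generator]
    exact (D Z).hasFDerivAt.comp_hasDerivAt s (hT s)
  · exact ((D Z).le_opNorm _).trans ((mul_le_mul_of_nonneg_left (norm_sum_le _ _)
      (norm_nonneg _)).trans (hmeet s hs))

theorem LiebRobinsonUpTo.sum_norm_le {c : ℝ} (h : LiebRobinsonUpTo c D T f X Λ M C) (hc : 0 ≤ c)
    (hdecay : HasDecay f (‖D ·‖) Λ M C) (Y : Finset Γ) (ht : 0 ≤ t) :
    ∑ Z ∈ Λ.powerset with ¬Disjoint Z Y, ‖D Z (T t)‖ ≤
      ‖T 0‖ * (M * (1 + C * lrGrowth M C t) * ∑ x ∈ X, ∑ y ∈ Y, f x y) +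
        c * ((∑ Z ∈ Λ.powerset, ‖D Z‖) * Real.exp (2 * (∑ Z ∈ Λ.powerset, ‖D Z‖) * t)) := by
  set σ := ∑ Z ∈ Λ.powerset, ‖D Z‖
  calc ∑ Z ∈ Λ.powerset with ¬Disjoint Z Y, ‖D Z (T t)‖
      ≤ ∑ Z ∈ Λ.powerset with ¬Disjoint Z Y, ‖D Z‖ *
          (‖T 0‖ * lrWeight f X (lrGrowth M C t) Z + c * Real.exp (2 * σ * t)) :=
        sum_le_sum fun Z _ => h Z t ht
    _ = ‖T 0‖ * ∑ Z ∈ Λ.powerset with ¬Disjoint Z Y, ‖D Z‖ * lrWeight f X (lrGrowth M C t) Z +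
          c * ((∑ Z ∈ Λ.powerset with ¬Disjoint Z Y, ‖D Z‖) * Real.exp (2 * σ * t)) := by
        rw [mul_sum _ _ ‖T 0‖, sum_mul, mul_sum _ _ c, ← sum_add_distrib]
        exact sum_congr rfl fun Z _ => by ring
    _ ≤ _ := by
        gcongr
        · exact hdecay.sum_mul_lrWeight_le X Y (lrGrowth_nonneg hdecay.rate_nonneg ht C)
        · exact sum_le_sum_of_subset_of_nonneg (filter_subset _ _) fun _ _ _ => norm_nonneg _

theorem LiebRobinsonUpTo.half {c : ℝ} (h : LiebRobinsonUpTo c D T f X Λ M C) (hc : 0 ≤ c)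
    (hD : IsLocalGenerator D) (hT : IsEvolution D Λ T) (hdecay : HasDecay f (‖D ·‖) Λ M C)
    (hloc : ∀ Z, Disjoint Z X → D Z (T 0) = 0) : LiebRobinsonUpTo (c / 2) D T f X Λ M C := by
  intro Z t ht
  set σ := ∑ Z' ∈ Λ.powerset, ‖D Z'‖
  have weight_hasDerivAt (s : ℝ) : HasDerivAt (fun s => lrWeight f X (lrGrowth M C s) Z)
      (M * (1 + C * lrGrowth M C s) * ∑ x ∈ X, ∑ z ∈ Z, f x z) s :=
    ((hasDerivAt_lrGrowth M C s).mul_const _).const_add _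
  have exp_hasDerivAt (s : ℝ) : HasDerivAt (fun s => Real.exp (2 * σ * s))
      (Real.exp (2 * σ * s) * (2 * σ)) s := (hasDerivAt_const_mul (2 * σ)).exp
  refine hD.norm_apply_le_of_hasDerivAt hT
    (fun s => (((weight_hasDerivAt s).const_mul ‖T 0‖).fun_add
      ((exp_hasDerivAt s).const_mul (c / 2))).const_mul ‖D Z‖) ?_ (fun s hs => ?_) ht
  · rw [lrGrowth_zero]
    have error_nonneg : 0 ≤ c / 2 * Real.exp (2 * σ * 0) := by positivity
    by_cases hd : Disjoint Z X
    · rw [hloc Z hd, norm_zero]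
      have := lrWeight_nonneg (X := X) (Z := Z) hdecay.kernel_nonneg le_rfl
      positivity
    · refine (D Z).le_opNorm_of_le ?_
      nlinarith [norm_nonneg (T 0), one_le_lrWeight_zero (f := f) hd]
  · refine mul_le_mul_of_nonneg_left ((h.sum_norm_le hc hdecay Z hs).trans_eq ?_) (norm_nonneg _)
    ring

theorem IsLocalGenerator.liebRobinson (hD : IsLocalGenerator D) (hT : IsEvolution D Λ T)
    (hdecay : HasDecay f (‖D ·‖) Λ M C) (hloc : ∀ Z, Disjoint Z X → D Z (T 0) = 0) :
    LiebRobinsonUpTo 0 D T f X Λ M C := by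
  have trivial_bound : LiebRobinsonUpTo ‖T 0‖ D T f X Λ M C := fun Z s hs => by
    refine (D Z).le_opNorm_of_le ((hD.norm_evolution_le hT hs).trans ?_)
    have weight_nonneg := lrWeight_nonneg (X := X) (Z := Z) hdecay.kernel_nonneg
      (lrGrowth_nonneg hdecay.rate_nonneg hs C)
    have one_le_exp : 1 ≤ Real.exp (2 * (∑ Z' ∈ Λ.powerset, ‖D Z'‖) * s) :=
      Real.one_le_exp (by positivity)
    nlinarith [norm_nonneg (T 0)]
  have halved (n : ℕ) : LiebRobinsonUpTo (‖T 0‖ / 2 ^ n) D T f X Λ M C := by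
    induction n with
    | zero => simpa using trivial_bound
    | succ n ih =>
      rw [pow_succ, ← div_div]
      exact ih.half (by positivity) hD hT hdecay hloc
  have error_tendsto : Tendsto (fun n : ℕ => ‖T 0‖ / 2 ^ n) atTop (nhds 0) :=
    tendsto_const_nhds.div_atTop (tendsto_pow_atTop_atTop_of_one_lt one_lt_two)
  exact fun Z s hs => ge_of_tendsto' (((error_tendsto.mul_const _).const_add _).const_mul _)
    fun n => halved n Z s hs

theorem powerset_sdiff_powerset_subset (Λ Y : Finset Γ) :
    Λ.powerset \ Y.powerset ⊆ Λ.powerset.filter fun Z => ¬Disjoint Z (Λ \ Y) := by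
  intro Z hZ
  rw [Finset.mem_sdiff, mem_powerset, mem_powerset] at hZ
  obtain ⟨y, hyZ, hyY⟩ := not_subset.1 hZ.2
  exact mem_filter.2 ⟨mem_powerset.2 hZ.1,
    not_disjoint_iff.2 ⟨y, hyZ, Finset.mem_sdiff.2 ⟨hZ.1 hyZ, hyY⟩⟩⟩

theorem IsLocalGenerator.norm_evolution_sub_evolution_le (hD : IsLocalGenerator D)
    (hT : IsEvolution D Λ T) (hT' : IsEvolution D Y T') (h0 : T 0 = T' 0) (hY : Y ⊆ Λ)
    (hdecay : HasDecay f (‖D ·‖) Λ M C) (hloc : ∀ Z, Disjoint Z X → D Z (T 0) = 0)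
    (ht : 0 ≤ t) :
    ‖T t - T' t‖ ≤ ‖T 0‖ * (lrGrowth M C t * ∑ x ∈ X, ∑ y ∈ Λ \ Y, f x y) := by
  refine (hD.isDissipative Y.powerset).norm_le_of_hasDerivAt (u := fun s => T s - T' s)
    (f := fun s => ∑ Z ∈ Λ.powerset \ Y.powerset, D Z (T s)) (fun s => ?_)
    (fun s => ((hasDerivAt_lrGrowth M C s).mul_const _).const_mul ‖T 0‖) ?_ (fun s hs => ?_) ht
  · refine ((hT s).sub (hT' s)).congr_deriv ?_
    rw [← sum_sdiff (powerset_mono.2 hY)]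
    simp only [map_sub, sum_sub_distrib]
    abel
  · simp [h0, lrGrowth_zero]
  · have meet_le := (hD.liebRobinson hT hdecay hloc).sum_norm_le le_rfl hdecay (Λ \ Y) hs
    rw [zero_mul, add_zero] at meet_le
    exact (norm_sum_le _ _).trans ((sum_le_sum_of_subset_of_nonneg
      (powerset_sdiff_powerset_subset Λ Y) fun _ _ _ => norm_nonneg _).trans meet_le)

end LiebRobinson

/-! ### Finite-volume dynamics -/

section Dynamics

variable {Γ : Type*} [DecidableEq Γ] {q : Γ → ℕ} {L : Interaction q} {X Y Z Z' Λ : Finset Γ}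

/-- The local term `L_Z` acting on `A_Λ`; it is `0` unless `Z ⊆ Λ`. -/
def localTerm (L : Interaction q) (Λ Z : Finset Γ) : Module.End ℂ (Obs q Λ) :=
  if h : Z ⊆ Λ then extend q h (L.term Z) else 0

theorem localTerm_of_subset (h : Z ⊆ Λ) : localTerm L Λ Z = extend q h (L.term Z) := dif_pos h

theorem localTerm_of_not_subset (h : ¬Z ⊆ Λ) : localTerm L Λ Z = 0 := dif_neg h

theorem generator_apply (Λ : Finset Γ) (B : Obs q Λ) :
    generator L Λ B = ∑ Z ∈ Λ.powerset, localTerm L Λ Z B := by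
  rw [generator, LinearMap.coe_toContinuousLinearMap', LinearMap.sum_apply,
    ← Finset.sum_attach Λ.powerset]
  exact Finset.sum_congr rfl fun Z _ => by rw [localTerm_of_subset]

theorem isLindblad_localTerm (L : Interaction q) (Λ Z : Finset Γ) :
    IsLindblad (localTerm L Λ Z) := by
  by_cases h : Z ⊆ Λ
  · rw [localTerm_of_subset h]
    exact isLindblad_extend h (L.lindblad Z)
  · rw [localTerm_of_not_subset h, ← Finset.sum_empty (ι := Finset Γ) (f := localTerm L Λ)]
    exact isLindblad_sum ∅ fun _ h => absurd h (Finset.notMem_empty _)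

theorem commute_localTerm (hd : Disjoint Z Z') :
    Commute (localTerm L Λ Z) (localTerm L Λ Z') := by
  by_cases h : Z ⊆ Λ
  · by_cases h' : Z' ⊆ Λ
    · rw [localTerm_of_subset h, localTerm_of_subset h']
      exact extend_commute h h' hd (L.lindblad Z) (L.lindblad Z')
    · exact localTerm_of_not_subset (L := L) h' ▸ Commute.zero_right _
  · exact localTerm_of_not_subset (L := L) h ▸ Commute.zero_left _

theorem localTerm_embed_of_disjoint (hX : X ⊆ Λ) (hd : Disjoint Z X) (A : Obs q X) :
    localTerm L Λ Z (embed q hX A) = 0 := by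
  by_cases h : Z ⊆ Λ
  · rw [localTerm_of_subset h]
    exact extend_embed_of_disjoint h hX hd (L.lindblad Z) A
  · rw [localTerm_of_not_subset h, LinearMap.zero_apply]

theorem embed_localTerm (hZ : Z ⊆ Y) (hY : Y ⊆ Λ) (A : Obs q Y) :
    embed q hY (localTerm L Y Z A) = localTerm L Λ Z (embed q hY A) := by
  rw [localTerm_of_subset hZ, localTerm_of_subset (hZ.trans hY)]
  exact embed_extend hZ hY (L.lindblad Z) A

/-- `localTerm` as a continuous real-linear map, the form required by `IsLocalGenerator`. -/
def localTermCLM (L : Interaction q) (Λ Z : Finset Γ) : Obs q Λ →L[ℝ] Obs q Λ :=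
  (LinearMap.toContinuousLinearMap (localTerm L Λ Z)).restrictScalars ℝ

theorem enorm_localTermCLM_le (L : Interaction q) (Λ Z : Finset Γ) :
    ‖localTermCLM L Λ Z‖ₑ ≤ cbNorm (L.term Z) := by
  have enorm_eq : ‖localTermCLM L Λ Z‖ₑ =
      ‖LinearMap.toContinuousLinearMap (localTerm L Λ Z)‖ₑ :=
    enorm_eq_iff_norm_eq.2 (ContinuousLinearMap.norm_restrictScalars _)
  rw [enorm_eq]
  by_cases h : Z ⊆ Λ
  · rw [localTerm_of_subset h]
    exact enorm_extend_le h (L.term Z)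
  · rw [localTerm_of_not_subset h, map_zero, ← ofReal_norm,
      norm_zero, ENNReal.ofReal_zero]
    exact zero_le

theorem isLocalGenerator_localTermCLM (L : Interaction q) (Λ : Finset Γ) :
    IsLocalGenerator (localTermCLM L Λ) where
  commute hd := ContinuousLinearMap.ext fun B =>
    LinearMap.congr_fun (commute_localTerm (L := L) (Λ := Λ) hd).eq B
  isDissipative S := by
    have := (isLindblad_sum S fun Z _ => isLindblad_localTerm L Λ Z).isDissipative
    rwa [LinearMap.coe_sum, Finset.sum_fn] at this

theorem dynamics_zero (Λ : Finset Γ) (A : Obs q Λ) : dynamics L Λ 0 A = A :=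
  exp_zero_smul_apply (generator L Λ) A

theorem isEvolution_dynamics (L : Interaction q) (A : Obs q Λ) :
    IsEvolution (localTermCLM L Λ) Λ fun s => dynamics L Λ s A := by
  intro s
  refine (hasDerivAt_exp_smul_apply (generator L Λ) A s).congr_deriv ?_
  exact generator_apply Λ _

theorem isEvolution_embed_dynamics (L : Interaction q) (hY : Y ⊆ Λ) (A : Obs q Y) :
    IsEvolution (localTermCLM L Λ) Y fun s => embed q hY (dynamics L Y s A) := by
  intro s
  let J : Obs q Y →L[ℂ] Obs q Λ :=
    LinearMap.toContinuousLinearMap (embedHom q hY).toAlgHom.toLinearMap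
  refine ((J.restrictScalars ℝ).hasFDerivAt.comp_hasDerivAt s
    (isEvolution_dynamics L A s)).congr_deriv ?_
  rw [map_sum]
  exact Finset.sum_congr rfl fun Z hZ => embed_localTerm (Finset.mem_powerset.1 hZ) hY _

theorem hasDecay_localTermCLM {f : Γ → Γ → ℝ} {M C : ℝ} (hf : ∀ x y, 0 ≤ f x y) (hM : 0 ≤ M)
    (hconv : ∀ x y, ∑ z ∈ Λ, f x z * f z y ≤ C * f x y)
    (hL : ∀ x y, ∑ Z ∈ Λ.powerset with x ∈ Z ∧ y ∈ Z, cbNorm (L.term Z) ≤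
      ENNReal.ofReal (M * f x y)) : HasDecay f (‖localTermCLM L Λ ·‖) Λ M C where
  kernel_nonneg := hf
  weight_nonneg _ := norm_nonneg _
  rate_nonneg := hM
  conv_le := hconv
  sum_weight_le x y := by
    refine (ENNReal.ofReal_le_ofReal_iff (mul_nonneg hM (hf x y))).1 (le_trans ?_ (hL x y))
    rw [ENNReal.ofReal_sum_of_nonneg fun Z _ => norm_nonneg _]
    exact Finset.sum_le_sum fun Z _ => (ofReal_norm _).trans_le (enorm_localTermCLM_le L Λ Z)

end Dynamics

section Decay

variable {Γ : Type*} [MetricSpace Γ] {F : ℝ → ℝ} {C : ℝ}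

theorem IsConvBound.sum_le (hF : ∀ r, 0 ≤ r → 0 < F r) (hC : IsConvBound Γ F C)
    (Λ : Finset Γ) (x y : Γ) :
    ∑ z ∈ Λ, F (dist x z) * F (dist z y) ≤ C * F (dist x y) := by
  have h := (ENNReal.sum_le_tsum Λ).trans (hC.2 x y)
  rw [← ENNReal.ofReal_sum_of_nonneg fun z _ =>
    mul_nonneg (hF _ dist_nonneg).le (hF _ dist_nonneg).le] at h
  exact (ENNReal.ofReal_le_ofReal_iff (mul_nonneg hC.1.le (hF _ dist_nonneg).le)).1 h

theorem IsDecayFunction.sum_le (hF : IsDecayFunction Γ F) (Λ : Finset Γ) (x y : Γ) :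
    ∑ z ∈ Λ, F (dist x z) * F (dist z y) ≤ convConst Γ F * F (dist x y) := by
  rw [← div_le_iff₀ (hF.pos _ dist_nonneg)]
  refine le_csInf hF.conv fun C hC => ?_
  rw [div_le_iff₀ (hF.pos _ dist_nonneg)]
  exact hC.sum_le hF.pos Λ x y

theorem convConst_nonneg (Γ : Type*) [MetricSpace Γ] (F : ℝ → ℝ) : 0 ≤ convConst Γ F :=
  Real.sInf_nonneg fun _ hC => hC.1.le

variable [DecidableEq Γ] {q : Γ → ℕ} {L : Interaction q} {x y : Γ}

theorem tsum_cbNorm_le (hF : 0 < F (dist x y)) :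
    ∑' Z : {Z : Finset Γ // x ∈ Z ∧ y ∈ Z}, cbNorm (L.term Z.1) ≤
      interactionNorm F L * ENNReal.ofReal (F (dist x y)) := by
  have h0 : ENNReal.ofReal (F (dist x y)) ≠ 0 := (ENNReal.ofReal_pos.2 hF).ne'
  rw [← ENNReal.div_le_iff h0 ENNReal.ofReal_ne_top]
  refine le_sInf fun M hM => ?_
  rw [ENNReal.div_le_iff h0 ENNReal.ofReal_ne_top]
  exact hM x y

theorem sum_cbNorm_le (hF : 0 < F (dist x y)) (hL : interactionNorm F L < ⊤) (Λ : Finset Γ) :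
    ∑ Z ∈ Λ.powerset with x ∈ Z ∧ y ∈ Z, cbNorm (L.term Z) ≤
      ENNReal.ofReal ((interactionNorm F L).toReal * F (dist x y)) := by
  rw [ENNReal.ofReal_mul ENNReal.toReal_nonneg, ENNReal.ofReal_toReal hL.ne,
    ← Finset.sum_subtype_eq_sum_filter]
  exact (ENNReal.sum_le_tsum _).trans (tsum_cbNorm_le hF)

end Decay

theorem lrGrowth_le {M C N t : ℝ} (hM : 0 ≤ M) (hC : 0 ≤ C) (hN : 0 ≤ N) (ht : 0 ≤ t) :
    lrGrowth M C t ≤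
      M * (t + (C + N) / C * ∫ s in (0 : ℝ)..t, (Real.exp (M * C * s) - 1)) := by
  set I := ∫ s in (0 : ℝ)..t, (Real.exp (M * C * s) - 1) with hI
  have integral_eq : ∫ s in (0 : ℝ)..t, Real.exp (M * C * s) = t + I := by
    rw [hI, intervalIntegral.integral_sub (Continuous.intervalIntegrable (by fun_prop) _ _)
      intervalIntegrable_const]
    simp
  have I_nonneg : 0 ≤ I := intervalIntegral.integral_nonneg ht fun s hs =>
    sub_nonneg.2 (Real.one_le_exp (mul_nonneg (mul_nonneg hM hC) hs.1))
  rw [lrGrowth, integral_eq]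
  gcongr
  obtain rfl | hC := hC.eq_or_lt
  · simp [hI]
  · exact le_mul_of_one_le_left I_nonneg ((one_le_div hC).2 (le_add_of_nonneg_right hN))

end QSpin

end

theorem theorem2p8_general {Γ : Type*} [DecidableEq Γ] {q : Γ → ℕ} (L : QSpin.Interaction q)
    {f : Γ → Γ → ℝ} (hf : ∀ x y, 0 ≤ f x y) {M C : ℝ} (hM : 0 ≤ M) {X Y Λ : Finset Γ}
    (hconv : ∀ x y, ∑ z ∈ Λ, f x z * f z y ≤ C * f x y)
    (hL : ∀ x y, ∑ Z ∈ Λ.powerset with x ∈ Z ∧ y ∈ Z, QSpin.cbNorm (L.term Z) ≤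
      ENNReal.ofReal (M * f x y))
    (hXY : X ⊆ Y) (hY : Y ⊆ Λ) (A : QSpin.Obs q X) {t : ℝ} (ht : 0 ≤ t) :
    ‖QSpin.dynamics L Λ t (QSpin.embed q (hXY.trans hY) A) -
        QSpin.embed q hY (QSpin.dynamics L Y t (QSpin.embed q hXY A))‖ ≤
      ‖A‖ * (M * ∫ s in (0 : ℝ)..t, Real.exp (M * C * s)) *
        ∑ x ∈ X, ∑ y ∈ Λ \ Y, f x y := by
  have initial_eq := QSpin.dynamics_zero (L := L) Λ (QSpin.embed q (hXY.trans hY) A)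
  refine ((QSpin.isLocalGenerator_localTermCLM L Λ).norm_evolution_sub_evolution_le (X := X)
    (QSpin.isEvolution_dynamics L (QSpin.embed q (hXY.trans hY) A))
    (QSpin.isEvolution_embed_dynamics L hY (QSpin.embed q hXY A))
    ?_ hY (QSpin.hasDecay_localTermCLM hf hM hconv hL) (fun Z hd => ?_) ht).trans ?_
  · rw [initial_eq, QSpin.dynamics_zero, QSpin.embed_trans]
  · rw [initial_eq]
    exact QSpin.localTerm_embed_of_disjoint (hXY.trans hY) hd A
  · rw [initial_eq, ← mul_assoc]
    have decay_nonneg : 0 ≤ ∑ x ∈ X, ∑ y ∈ Λ \ Y, f x y :=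
      Finset.sum_nonneg fun x _ => Finset.sum_nonneg fun y _ => hf x y
    have growth_nonneg := QSpin.lrGrowth_nonneg hM ht C
    gcongr ?_ * _ * _
    exact QSpin.norm_embed_le (hXY.trans hY) A

theorem theorem2p8 {Γ : Type*} [MetricSpace Γ] [Countable Γ] [DecidableEq Γ]
    (q : Γ → ℕ) (F : ℝ → ℝ) (hF : QSpin.IsDecayFunction Γ F)
    (L : QSpin.Interaction q) (hL : QSpin.interactionNorm F L < ⊤)
    (X : Finset Γ) (A : QSpin.Obs q X) (Λ : Finset Γ) (hX : X ⊆ Λ)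
    (t : ℝ) (ht : 0 ≤ t) (r : ℝ) (hr : 1 ≤ r) :
    ‖QSpin.dynamics L Λ t (QSpin.embed q hX A) -
        QSpin.embed q (QSpin.inflate_subset Λ X r)
          (QSpin.dynamics L (QSpin.inflate Λ X r) t
            (QSpin.embed q (QSpin.subset_inflate hX hr) A))‖ ≤
      ‖A‖ * (QSpin.interactionNorm F L).toReal *
        (t + (QSpin.convConst Γ F + (QSpin.decayNorm Γ F).toReal) / QSpin.convConst Γ F *
          ∫ s in (0 : ℝ)..t,
            (Real.exp ((QSpin.interactionNorm F L).toReal * QSpin.convConst Γ F * s) - 1)) *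
        ∑ x ∈ X, ∑ y ∈ Λ \ QSpin.inflate Λ X r, F (dist x y) := by
  have hf (x y : Γ) : 0 < F (dist x y) := hF.pos _ dist_nonneg
  refine (theorem2p8_general L (fun x y => (hf x y).le) ENNReal.toReal_nonneg (hF.sum_le Λ)
    (fun x y => QSpin.sum_cbNorm_le (hf x y) hL Λ) (QSpin.subset_inflate hX hr)
    (QSpin.inflate_subset Λ X r) A ht).trans ?_
  rw [mul_assoc ‖A‖ (QSpin.interactionNorm F L).toReal]
  gcongr ‖A‖ * ?_ * _
  · exact Finset.sum_nonneg fun x _ => Finset.sum_nonneg fun y _ => (hf x y).le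
  · exact QSpin.lrGrowth_le ENNReal.toReal_nonneg (QSpin.convConst_nonneg Γ F)
      ENNReal.toReal_nonneg ht
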